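/- Let $2 \le \alpha < 3$, put $a_\alpha = -\cos(\alpha\pi/2)$ and $h_\alpha(\xi) = |\xi| / \sqrt{1 + a_\alpha |\xi|^\alpha}$ for $\xi \in \mathbb{R}$, and let $H$ denote the Heaviside function. For $t \in \mathbb{R}$ let $$E_0(t) = \mathcal{F}^{-1}_{\xi \to x}\big[\cos(h_\alpha(\xi)\, t)\, H(t)\big], \qquad E_1(t) = \mathcal{F}^{-1}_{\xi \to x}\Big[\frac{\sin(h_\alpha(\xi)\, t)}{h_\alpha(\xi)}\, H(t)\Big] \quad \text{in } \mathcal{S}'(\mathbb{R}),$$ where $\mathcal{F}w(\xi) = \int e^{-ix\xi} w(x)\,dx$. These define tempered distributions $E_0, E_1$ on $\mathbb{R}^2$ (the fundamental solutions of the fractional Eringen wave equation) by $\langle E_j, \varphi\rangle = \int_{\mathbb{R}} \langle E_j(t), \varphi(\cdot, t)\rangle\, dt$. For $j = 0, 1$ let $E_j^+$ be the restriction of $E_j$ to the open half-plane $\{(x,t) \in \mathbb{R}^2 : t > 0\}$. Then the ($C^\infty$) wave front sets satisfy $$\mathrm{WF}(E_j^+) \subseteq \{(0, t; \xi, 0)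 : t > 0,\ \xi \ne 0\} =: W_0 \qquad (j = 0, 1).$$ -/

import Mathlib

open MeasureTheory TopologicalSpace Function
open scoped SchwartzMap Distributions FourierTransform ContDiff

noncomputable section

namespace Eringen

/-! ### Distributions on an open set: complex test functions and restriction -/

section Distributions

variable {E : Type*} [NormedAddCommGroup E] [NormedSpace ℝ E]

/-- Value of a complex distribution on a complex-valued test function `ψ`: the `ℂ`-linear
extension `u(Re ψ) + i u(Im ψ)` of the distribution (Mathlib's distributions are given by their
values on real-valued test functions). -/
def evalComplex {Ω : Opens E} (u : 𝓓'(Ω, ℂ)) (ψ : 𝓓(Ω, ℂ)) : ℂ :=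
  u (TestFunction.postcompCLM Complex.reCLM ψ) +
    Complex.I * u (TestFunction.postcompCLM Complex.imCLM ψ)

/-- A real-valued test function on `Ω`, extended by zero, as a complex Schwartz function. -/
def toSchwartz {Ω : Opens E} (φ : 𝓓(Ω, ℝ)) : 𝓢(E, ℂ) :=
  HasCompactSupport.toSchwartzMap (f := fun x => (φ x : ℂ))
    (φ.hasCompactSupport.comp_left (g := fun r : ℝ => (r : ℂ)) Complex.ofReal_zero)
    (Complex.ofRealCLM.contDiff.comp φ.contDiff)

@[simp]
theorem toSchwartz_apply {Ω : Opens E} (φ : 𝓓(Ω, ℝ)) (x : E) :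
    toSchwartz φ x = (φ x : ℂ) := rfl

/-- The inclusion of test functions into the Schwartz space, as a continuous linear map. -/
def toSchwartzCLM (Ω : Opens E) : 𝓓(Ω, ℝ) →L[ℝ] 𝓢(E, ℂ) :=
  TestFunction.mkCLM ℝ toSchwartz
    (fun f g => by ext x; simp)
    (fun c f => by ext x; simp)
    (fun K hK => by
      let L : 𝓓_{K}(E, ℝ) →ₗ[ℝ] 𝓢(E, ℂ) :=
        { toFun := toSchwartz ∘ TestFunction.ofSupportedIn hK
          map_add' := fun f g => by ext x; simp
          map_smul' := fun c f => by ext x; simp }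
      change Continuous L
      refine WithSeminorms.continuous_of_isBounded
        (ContDiffMapSupportedIn.withSeminorms ℝ E ℝ ⊤ K) (schwartz_withSeminorms ℝ E ℂ) L ?_
      rintro ⟨k, n⟩
      obtain ⟨R, hR⟩ := K.isCompact.isBounded.exists_norm_le
      have hR0 : 0 ≤ (max R 0) ^ k := pow_nonneg (le_max_right _ _) k
      refine ⟨{n}, ⟨(max R 0) ^ k, hR0⟩, fun f => ?_⟩
      have hL : (L f : E → ℂ) = Complex.ofRealLI ∘ f := rfl
      have hn : ∀ x, ‖iteratedFDeriv ℝ n (L f) x‖ = ‖iteratedFDeriv ℝ n f x‖ := fun x => by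
        rw [hL]
        exact Complex.ofRealLI.norm_iteratedFDeriv_comp_left
          (f.contDiff.contDiffAt.of_le (mod_cast le_top)) le_rfl
      refine (L f).seminorm_le_bound ℝ k n (mul_nonneg hR0 (apply_nonneg _ _)) fun x => ?_
      rw [hn x]
      simp only [Finset.sup_singleton]
      by_cases hx : x ∈ K
      · have h1 : ‖x‖ ≤ max R 0 := (hR x hx).trans (le_max_left _ _)
        have h2 := ContDiffMapSupportedIn.norm_iteratedFDeriv_apply_le_seminorm_top ℝ
          (f := f) (i := n) (x := x)
        exact mul_le_mul (pow_le_pow_left₀ (norm_nonneg _) h1 k) h2 (norm_nonneg _) hR0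
      · rw [f.iteratedFDeriv_zero_on_compl hx]
        simp only [Pi.zero_apply, norm_zero, mul_zero]
        exact mul_nonneg hR0 (apply_nonneg _ _))

/-- The restriction of a tempered distribution to an open set. -/
def restrict (Ω : Opens E) (T : 𝓢'(E, ℂ)) : 𝓓'(Ω, ℂ) where
  toFun φ := T (toSchwartzCLM Ω φ)
  map_add' f g := by simp
  map_smul' c f := by
    rw [map_smul, ← Complex.coe_smul, map_smul, RingHom.id_apply, Complex.coe_smul]
  cont := T.continuous.comp (toSchwartzCLM Ω).continuous

@[simp]
theorem restrict_apply (Ω : Opens E) (T : 𝓢'(E, ℂ)) (φ : 𝓓(Ω, ℝ)) :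
    restrict Ω T φ = T (toSchwartz φ) := rfl

end Distributions

/-! ### The wave front set of a distribution on an open subset of the `(x, t)`-plane -/

/-- The test function `(x, t) ↦ φ (x, t) * exp (-i (x ξ + t τ))` for `ζ = (ξ, τ)`. -/
def modulate {Ω : Opens (ℝ × ℝ)} (φ : 𝓓(Ω, ℂ)) (ζ : ℝ × ℝ) : 𝓓(Ω, ℂ) where
  toFun z := φ z * Complex.exp (-Complex.I * ((z.1 * ζ.1 + z.2 * ζ.2 : ℝ) : ℂ))
  contDiff' := φ.contDiff.mul
    ((contDiff_const.mul (Complex.ofRealCLM.contDiff.comp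
      ((contDiff_fst.mul contDiff_const).add (contDiff_snd.mul contDiff_const)))).cexp)
  hasCompactSupport' := φ.hasCompactSupport.mul_right
  tsupport_subset' := (tsupport_mul_subset_left).trans φ.tsupport_subset

/-- The Fourier transform `(φ u)^(ζ) = ⟨u, φ exp (-i ⟨·, ζ⟩)⟩` of the compactly supported
distribution `φ u`. -/
def fourierCutoff {Ω : Opens (ℝ × ℝ)} (u : 𝓓'(Ω, ℂ)) (φ : 𝓓(Ω, ℂ)) (ζ : ℝ × ℝ) : ℂ :=
  evalComplex u (modulate φ ζ)

/-- `u` is microlocally smooth at `(z, ζ₀)`: for some test function `φ` with `φ z ≠ 0`, the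
Fourier transform of `φ u` is rapidly decreasing in an open conic neighbourhood of `ζ₀`. -/
def IsMicrolocallySmoothAt {Ω : Opens (ℝ × ℝ)} (u : 𝓓'(Ω, ℂ)) (z ζ₀ : ℝ × ℝ) : Prop :=
  ∃ φ : 𝓓(Ω, ℂ), φ z ≠ 0 ∧
    ∃ V : Set (ℝ × ℝ), IsOpen V ∧ ζ₀ ∈ V ∧ (∀ ζ ∈ V, ∀ s : ℝ, 0 < s → s • ζ ∈ V) ∧
      ∀ N : ℕ, ∃ C : ℝ, ∀ ζ ∈ V, ‖fourierCutoff u φ ζ‖ ≤ C * ((1 + ‖ζ‖) ^ N)⁻¹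

/-- The wave front set of `u ∈ 𝓓'(Ω)`, a subset of `Ω × (ℝ² \ {0})`. -/
def waveFrontSet {Ω : Opens (ℝ × ℝ)} (u : 𝓓'(Ω, ℂ)) : Set ((ℝ × ℝ) × (ℝ × ℝ)) :=
  {p | p.1 ∈ Ω ∧ p.2 ≠ 0 ∧ ¬ IsMicrolocallySmoothAt u p.1 p.2}

/-! ### The fundamental solutions -/

/-- The constant `a_α = - cos (α π / 2)`. -/
def aCoeff (α : ℝ) : ℝ := -Real.cos (α * Real.pi / 2)

/-- `h_α(ξ) = |ξ| / √(1 + a_α |ξ|^α)`. -/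
def hSymbol (α ξ : ℝ) : ℝ := |ξ| / √(1 + aCoeff α * |ξ| ^ α)

/-- The spatial Fourier transforms of the fundamental solutions: `cos (h_α(ξ) t) H(t)` for `j = 0`
and `sin (h_α(ξ) t) / h_α(ξ) H(t)` for `j = 1`. (The value at `ξ = 0`, where the last quotient
is `0 / 0`, is irrelevant since a single point is a null set.) -/
def fundSymbol (α : ℝ) : Fin 2 → ℝ → ℝ → ℝ
  | 0, t, ξ => if 0 < t then Real.cos (hSymbol α ξ * t) else 0
  | 1, t, ξ => if 0 < t then Real.sin (hSymbol α ξ * t) / hSymbol α ξ else 0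

theorem measurable_hSymbol (α : ℝ) : Measurable (hSymbol α) := by
  unfold hSymbol
  fun_prop

theorem measurable_fundSymbol (α : ℝ) (j : Fin 2) :
    Measurable fun p : ℝ × ℝ => fundSymbol α j p.1 p.2 := by
  have hh : Measurable fun p : ℝ × ℝ => hSymbol α p.2 := (measurable_hSymbol α).comp measurable_snd
  have hs : MeasurableSet {p : ℝ × ℝ | 0 < p.1} := measurableSet_lt measurable_const measurable_fst
  fin_cases j
  · exact Measurable.ite hs (Real.measurable_cos.comp (hh.mul measurable_fst)) measurable_const
  · exact Measurable.ite hs ((Real.measurable_sin.comp (hh.mul measurable_fst)).div hh)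
      measurable_const

theorem abs_fundSymbol_le (α : ℝ) (j : Fin 2) (t ξ : ℝ) : |fundSymbol α j t ξ| ≤ 1 + |t| := by
  fin_cases j
  · change |if 0 < t then Real.cos (hSymbol α ξ * t) else 0| ≤ 1 + |t|
    split_ifs
    · exact (Real.abs_cos_le_one _).trans (by linarith [abs_nonneg t])
    · simp only [abs_zero]; positivity
  · change |if 0 < t then Real.sin (hSymbol α ξ * t) / hSymbol α ξ else 0| ≤ 1 + |t|
    split_ifs
    · rw [abs_div]
      refine (div_le_of_le_mul₀ (abs_nonneg _) (abs_nonneg t) ?_).trans (by linarith)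
      exact (Real.abs_sin_le_abs).trans (by rw [abs_mul, mul_comm])
    · simp only [abs_zero]; positivity

theorem measurable_fundSymbol_scaled (α : ℝ) (j : Fin 2) :
    Measurable fun p : ℝ × ℝ => (fundSymbol α j p.1 (2 * Real.pi * p.2) : ℂ) :=
  Complex.measurable_ofReal.comp ((measurable_fundSymbol α j).comp
    (measurable_fst.prodMk (measurable_snd.const_mul _)))

theorem memLp_fundSymbol (α : ℝ) (j : Fin 2) (t : ℝ) :
    MemLp (fun η : ℝ => (fundSymbol α j t (2 * Real.pi * η) : ℂ)) ⊤ := by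
  refine memLp_top_of_bound (C := 1 + |t|)
    ((measurable_fundSymbol_scaled α j).comp measurable_prodMk_left).aestronglyMeasurable ?_
  filter_upwards with η
  rw [Complex.norm_real]
  exact abs_fundSymbol_le α j t _

/-- `E_j(t)`, the inverse spatial Fourier transform of the bounded function
`ξ ↦ fundSymbol α j t ξ`, as a tempered distribution on `ℝ`. The Fourier transform meant here is
`∫ exp (-i x ξ) w(x) dx`; Mathlib's is `∫ exp (-2 π i x η) w(x) dx`, so that `ξ = 2 π η`. -/
def fundSolutionAt (α : ℝ) (j : Fin 2) (t : ℝ) : 𝓢'(ℝ, ℂ) :=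
  𝓕⁻ (Lp.toTemperedDistribution ((memLp_fundSymbol α j t).toLp) : 𝓢'(ℝ, ℂ))

theorem fundSolutionAt_apply (α : ℝ) (j : Fin 2) (t : ℝ) (ψ : 𝓢(ℝ, ℂ)) :
    fundSolutionAt α j t ψ = ∫ η, 𝓕⁻ ψ η * (fundSymbol α j t (2 * Real.pi * η) : ℂ) := by
  rw [fundSolutionAt, TemperedDistribution.fourierInv_apply, Lp.toTemperedDistribution_apply]
  refine integral_congr_ae ?_
  filter_upwards [(memLp_fundSymbol α j t).coeFn_toLp] with η hη
  rw [hη, smul_eq_mul]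

theorem norm_fundSolutionAt_le (α : ℝ) (j : Fin 2) (t : ℝ) (ψ : 𝓢(ℝ, ℂ)) :
    ‖fundSolutionAt α j t ψ‖ ≤ (1 + |t|) * ‖(𝓕⁻ ψ).toLp 1‖ := by
  rw [fundSolutionAt_apply, SchwartzMap.norm_toLp_one, ← integral_const_mul]
  refine norm_integral_le_of_norm_le ((𝓕⁻ ψ).integrable.norm.const_mul _) ?_
  filter_upwards with η
  rw [norm_mul, mul_comm, Complex.norm_real]
  exact mul_le_mul_of_nonneg_right (abs_fundSymbol_le α j t _) (norm_nonneg _)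

/-- The slice `x ↦ φ (x, t)` of a Schwartz function on the plane. -/
def slice (t : ℝ) : 𝓢(ℝ × ℝ, ℂ) →L[ℂ] 𝓢(ℝ, ℂ) :=
  SchwartzMap.compCLMOfAntilipschitz ℂ (K := 1) (g := fun x : ℝ => (x, t))
    (by
      have h := (ContinuousLinearMap.inl ℝ ℝ ℝ).hasTemperateGrowth.add
        (Function.HasTemperateGrowth.const ((0 : ℝ), t))
      convert h using 1
      ext x <;> simp)
    (AntilipschitzWith.of_le_mul_dist fun x y => by simp [Prod.dist_eq])

@[simp]
theorem slice_apply (t : ℝ) (φ : 𝓢(ℝ × ℝ, ℂ)) (x : ℝ) : slice t φ x = φ (x, t) := rfl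

theorem norm_iteratedFDeriv_slice_le (t : ℝ) (φ : 𝓢(ℝ × ℝ, ℂ)) (n : ℕ) (x : ℝ) :
    ‖iteratedFDeriv ℝ n (slice t φ) x‖ ≤ ‖iteratedFDeriv ℝ n φ (x, t)‖ := by
  let L : ℝ →L[ℝ] ℝ × ℝ := ContinuousLinearMap.inl ℝ ℝ ℝ
  have hL : ‖L‖ ≤ 1 := ContinuousLinearMap.norm_inl_le_one ℝ ℝ ℝ
  let G : ℝ × ℝ → ℂ := fun z => φ (((0 : ℝ), t) + z)
  have hG : ContDiff ℝ n G := (φ.smooth n).comp (by fun_prop)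
  have h1 : (slice t φ : ℝ → ℂ) = G ∘ L := by
    ext x
    simp [G, L]
  have h2 : iteratedFDeriv ℝ n G (L x) = iteratedFDeriv ℝ n φ (x, t) := by
    have := iteratedFDeriv_comp_add_left (𝕜 := ℝ) (f := φ) n ((0 : ℝ), t) (L x)
    rw [show (fun z => φ (((0 : ℝ), t) + z)) = G from rfl] at this
    rw [this]
    simp [L]
  rw [h1, L.iteratedFDeriv_comp_right hG x (i := n) le_rfl, h2]
  refine (ContinuousMultilinearMap.norm_compContinuousLinearMap_le _ _).trans ?_
  refine mul_le_of_le_one_right (norm_nonneg _) ?_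
  exact Finset.prod_le_one (fun _ _ => norm_nonneg _) (fun _ _ => hL)

theorem seminorm_slice_le (k n N : ℕ) (t : ℝ) (φ : 𝓢(ℝ × ℝ, ℂ)) :
    (1 + |t|) ^ N * SchwartzMap.seminorm ℂ k n (slice t φ) ≤
      2 ^ (N + k) * (Finset.Iic (N + k, n)).sup (schwartzSeminormFamily ℂ (ℝ × ℝ) ℂ) φ := by
  have ht : 0 < (1 + |t|) ^ N := by positivity
  rw [← le_div_iff₀' ht]
  refine SchwartzMap.seminorm_le_bound ℂ k n _ (by positivity) fun x => ?_
  rw [le_div_iff₀' ht]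
  refine le_trans ?_
    (SchwartzMap.one_add_le_sup_seminorm_apply (𝕜 := ℂ) (m := (N + k, n)) le_rfl le_rfl φ (x, t))
  have h1 : |t| ≤ ‖(x, t)‖ := le_max_right _ _
  have h2 : ‖x‖ ≤ ‖(x, t)‖ := le_max_left _ _
  rw [← mul_assoc, pow_add]
  refine mul_le_mul (mul_le_mul ?_ ?_ (by positivity) (by positivity))
    (norm_iteratedFDeriv_slice_le t φ n x) (norm_nonneg _) (by positivity)
  · exact pow_le_pow_left₀ (by positivity) (by linarith) N
  · exact pow_le_pow_left₀ (norm_nonneg _) (by linarith) k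

theorem exists_bound_slice (α : ℝ) (j : Fin 2) :
    ∃ (s : Finset (ℕ × ℕ)) (C : ℝ), 0 ≤ C ∧ ∀ (φ : 𝓢(ℝ × ℝ, ℂ)) (t : ℝ),
      ‖fundSolutionAt α j t (slice t φ)‖ ≤
        C * s.sup (schwartzSeminormFamily ℂ (ℝ × ℝ) ℂ) φ * (1 + t ^ 2)⁻¹ := by
  let A : 𝓢(ℝ, ℂ) →L[ℂ] Lp ℂ 1 (volume : Measure ℝ) :=
    (SchwartzMap.toLpCLM ℂ ℂ 1 volume).comp (FourierTransform.fourierInvCLM ℂ 𝓢(ℝ, ℂ))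
  have hA : ∀ ψ, ‖A ψ‖ = ‖(𝓕⁻ ψ).toLp 1‖ := fun ψ => rfl
  obtain ⟨s, C, -, hC⟩ := Seminorm.bound_of_continuous (schwartz_withSeminorms ℂ ℝ ℂ)
    ((normSeminorm ℂ (Lp ℂ 1 (volume : Measure ℝ))).comp A.toLinearMap)
    (continuous_norm.comp A.continuous)
  let M : ℝ := ∑ i ∈ s, 2 ^ (3 + i.1)
  let S : Finset (ℕ × ℕ) := s.biUnion fun i => Finset.Iic (3 + i.1, i.2)
  refine ⟨S, C * M, by positivity, fun φ t => ?_⟩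
  set Q := S.sup (schwartzSeminormFamily ℂ (ℝ × ℝ) ℂ) φ with hQ
  have hQ0 : 0 ≤ Q := apply_nonneg _ _
  have ht : 0 < (1 + |t|) ^ 3 := by positivity
  have hsup : (1 + |t|) ^ 3 * s.sup (schwartzSeminormFamily ℂ ℝ ℂ) (slice t φ) ≤ M * Q := by
    rw [← le_div_iff₀' ht]
    refine Seminorm.finset_sup_apply_le (by positivity) fun i hi => ?_
    rw [le_div_iff₀' ht]
    refine (seminorm_slice_le i.1 i.2 3 t φ).trans ?_
    refine mul_le_mul ?_ ?_ (apply_nonneg _ _) (by positivity)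
    · exact Finset.single_le_sum (f := fun i : ℕ × ℕ => (2 : ℝ) ^ (3 + i.1))
        (fun _ _ => by positivity) hi
    · exact Seminorm.le_def.1 (Finset.sup_mono
        (Finset.subset_biUnion_of_mem (fun i : ℕ × ℕ => Finset.Iic (3 + i.1, i.2)) hi)) φ
  have h1 : ‖A (slice t φ)‖ ≤ C * s.sup (schwartzSeminormFamily ℂ ℝ ℂ) (slice t φ) := hC (slice t φ)
  have h2 := norm_fundSolutionAt_le α j t (slice t φ)
  rw [← hA] at h2
  have hpos : (0 : ℝ) < 1 + t ^ 2 := by positivity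
  rw [← div_eq_mul_inv, le_div_iff₀ hpos]
  have h3 : 1 + t ^ 2 ≤ (1 + |t|) ^ 2 := by nlinarith [abs_nonneg t, sq_abs t]
  calc ‖fundSolutionAt α j t (slice t φ)‖ * (1 + t ^ 2)
      ≤ ((1 + |t|) * (C * s.sup (schwartzSeminormFamily ℂ ℝ ℂ) (slice t φ))) * (1 + |t|) ^ 2 := by
        refine mul_le_mul (h2.trans ?_) h3 hpos.le (by positivity)
        exact mul_le_mul_of_nonneg_left h1 (by positivity)
    _ = C * ((1 + |t|) ^ 3 * s.sup (schwartzSeminormFamily ℂ ℝ ℂ) (slice t φ)) := by ring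
    _ ≤ C * (M * Q) := mul_le_mul_of_nonneg_left hsup C.2
    _ = C * M * Q := by ring

theorem aestronglyMeasurable_slice (α : ℝ) (j : Fin 2) (φ : 𝓢(ℝ × ℝ, ℂ)) :
    AEStronglyMeasurable (fun t => fundSolutionAt α j t (slice t φ)) volume := by
  have h1 : StronglyMeasurable fun p : ℝ × ℝ => 𝓕⁻ (slice p.1 φ) p.2 := by
    have : (fun p : ℝ × ℝ => 𝓕⁻ (slice p.1 φ) p.2) =
        fun p : ℝ × ℝ => ∫ x : ℝ, Complex.exp ((2 * Real.pi * (x * p.2) : ℝ) * Complex.I) *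
          φ (x, p.1) := by
      ext p
      rw [SchwartzMap.fourierInv_coe, Real.fourierInv_eq']
      refine integral_congr_ae (Filter.Eventually.of_forall fun x => ?_)
      simp [mul_comm p.2]
    rw [this]
    refine StronglyMeasurable.integral_prod_right
      (f := fun (p : ℝ × ℝ) (x : ℝ) =>
        Complex.exp ((2 * Real.pi * (x * p.2) : ℝ) * Complex.I) * φ (x, p.1)) ?_
    refine Continuous.stronglyMeasurable ?_
    have hφ := φ.continuous
    fun_prop
  have h2 : StronglyMeasurable fun t => fundSolutionAt α j t (slice t φ) := by
    simp_rw [fundSolutionAt_apply]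
    refine StronglyMeasurable.integral_prod_right
      (f := fun (t η : ℝ) => 𝓕⁻ (slice t φ) η * (fundSymbol α j t (2 * Real.pi * η) : ℂ)) ?_
    exact h1.mul (measurable_fundSymbol_scaled α j).stronglyMeasurable
  exact h2.aestronglyMeasurable

theorem integrable_slice (α : ℝ) (j : Fin 2) (φ : 𝓢(ℝ × ℝ, ℂ)) :
    Integrable fun t => fundSolutionAt α j t (slice t φ) := by
  obtain ⟨s, C, -, h⟩ := exists_bound_slice α j
  exact (integrable_inv_one_add_sq.const_mul _).mono' (aestronglyMeasurable_slice α j φ)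
    (Filter.Eventually.of_forall (h φ))

/-- The fundamental solution `E_j`, `j = 0, 1`, as a tempered distribution on the `(x, t)`-plane:
`⟨E_j, φ⟩ = ∫ ⟨E_j(t), φ(·, t)⟩ dt`. -/
def fundSolution (α : ℝ) (j : Fin 2) : 𝓢'(ℝ × ℝ, ℂ) :=
  ContinuousLinearMap.toPointwiseConvergenceCLM _ _ _ _ <|
    SchwartzMap.mkCLMtoNormedSpace (𝕜 := ℂ) (σ := RingHom.id ℂ)
      (fun φ : 𝓢(ℝ × ℝ, ℂ) => ∫ t, fundSolutionAt α j t (slice t φ))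
      (fun f g => by
        simp_rw [map_add]
        exact integral_add (integrable_slice α j f) (integrable_slice α j g))
      (fun a f => by
        simp_rw [map_smul]
        exact integral_smul _ _)
      (by
        obtain ⟨s, C, hC, h⟩ := exists_bound_slice α j
        refine ⟨s, C * Real.pi, by positivity, fun f => ?_⟩
        refine (norm_integral_le_of_norm_le (integrable_inv_one_add_sq.const_mul _)
          (Filter.Eventually.of_forall (h f))).trans (le_of_eq ?_)
        rw [integral_const_mul, integral_univ_inv_one_add_sq]
        ring)

theorem fundSolution_apply (α : ℝ) (j : Fin 2) (φ : 𝓢(ℝ × ℝ, ℂ)) :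
    fundSolution α j φ = ∫ t, fundSolutionAt α j t (slice t φ) := rfl

/-- The open half-plane `{(x, t) | t > 0}`. -/
def upperHalf : Opens (ℝ × ℝ) :=
  ⟨{z | 0 < z.2}, isOpen_lt continuous_const continuous_snd⟩

/-- `E_j⁺`, the restriction of `E_j` to the open half-plane `t > 0`. -/
def fundSolutionPlus (α : ℝ) (j : Fin 2) : 𝓓'(upperHalf, ℂ) :=
  restrict upperHalf (fundSolution α j)

end Eringen

end

/-!
The localized Fourier transform of `E_j⁺` for the product cut-off `χ(x) ψ(t)`, `ψ` supported in
`t > 0`, is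
`∫ ψ(t) e^{-itτ} (∫ 𝓕χ(ξ/2π - η) m(t, 2πη) dη) dt`,
where `m(t, ξ)` is `cos (h_α(ξ) t)` or `sin (h_α(ξ) t) / h_α(ξ)` (`fourierCutoff_prodTest`).
Two decay estimates for it give the theorem.

*Decay in `τ`, for every `χ`.* Since `α ≥ 2`, the function `h_α` is bounded. After exchanging the
integrals, the time integral is an average, or a difference quotient, of the Fourier transform of
`ψ` at the frequencies `τ ± h_α(ξ)`, so it is rapidly decreasing in `τ` uniformly in `ξ`
(`exists_norm_integral_time_le`, `exists_fourierCutoff_le`). In a cone `|ξ| < M |τ|` this is rapid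
decay, so no covector with `τ ≠ 0` lies in the wave front set.

*Decay in `ξ`, for `χ` supported away from `x = 0`.* Here `m(t, ·)` is a symbol of order zero,
uniformly for bounded `t`: as `α < 3`, it extends holomorphically to the sector `|arg z| < π/6`
and is bounded there away from the origin, so that Cauchy's estimates on discs of radius
proportional to `η` bound its derivatives (`exists_isSymbolSeq_fundSymbol`). Dividing `χ` by
`-2πix` exhibits `𝓕χ` as the derivative of a function of the same kind, and repeated integration by
parts on `|η| > 1` gains one power of `η` each time; the boundary terms and the part `|η| ≤ 1`
are rapidly decreasing in `ξ` (`exists_norm_integral_conv_le`). Together with the decay in `τ` this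
is decay in all directions, so no point with `x ≠ 0` lies under the wave front set.
-/

noncomputable section

namespace Eringen

/-- The Fourier transform as a map of Schwartz functions on the line, with the types fixed so that
they need not be repeated at each use. -/
local notation "𝓕ₛ" => (FourierTransform.fourier : 𝓢(ℝ, ℂ) → 𝓢(ℝ, ℂ))

/-! ### Symbols convolved with Fourier transforms of functions supported away from the origin -/

theorem exists_schwartz_decay (F : 𝓢(ℝ, ℂ)) (N : ℕ) :
    ∃ K : ℝ, 0 ≤ K ∧ ∀ s, ‖F s‖ ≤ K * ((1 + |s|) ^ N)⁻¹ := by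
  refine ⟨2 ^ N * (Finset.Iic (N, 0)).sup (schwartzSeminormFamily ℂ ℝ ℂ) F, by positivity,
    fun s => ?_⟩
  have h := SchwartzMap.one_add_le_sup_seminorm_apply (𝕜 := ℂ) (m := (N, 0)) le_rfl le_rfl F s
  rw [norm_iteratedFDeriv_zero, Real.norm_eq_abs] at h
  rw [← div_eq_mul_inv, le_div_iff₀' (by positivity)]
  exact h

theorem one_add_abs_le_mul (y η : ℝ) : 1 + |y| ≤ (1 + |y - η|) * (1 + |η|) := by
  have h : |y| ≤ |y - η| + |η| := by simpa using abs_add_le (y - η) η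
  nlinarith [abs_nonneg (y - η), abs_nonneg η]

/-- Convolution with a Schwartz function preserves decay of order `N`; by Peetre's inequality
`1 + |y| ≤ (1 + |y - η|) (1 + |η|)`. -/
theorem exists_norm_setIntegral_conv_le (F : 𝓢(ℝ, ℂ)) (N : ℕ) :
    ∃ K : ℝ, 0 ≤ K ∧ ∀ (C : ℝ) (m : ℝ → ℂ) (S : Set ℝ), 0 ≤ C → MeasurableSet S →
      (∀ η ∈ S, ‖m η‖ ≤ C * ((1 + |η|) ^ N)⁻¹) →
      ∀ y, ‖∫ η in S, F (y - η) * m η‖ ≤ K * C * ((1 + |y|) ^ N)⁻¹ := by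
  obtain ⟨K, hK0, hK⟩ := exists_schwartz_decay F (N + 2)
  refine ⟨K * Real.pi, by positivity, fun C m S hC hS hm y => ?_⟩
  set A : ℝ := K * C * ((1 + |y|) ^ N)⁻¹ with hA
  have hA0 : 0 ≤ A := by positivity
  have hint : Integrable fun η : ℝ => A * (1 + (y - η) ^ 2)⁻¹ :=
    (integrable_inv_one_add_sq.comp_sub_left y).const_mul A
  have hle : ‖∫ η in S, F (y - η) * m η‖ ≤ ∫ η in S, A * (1 + (y - η) ^ 2)⁻¹ := by
    refine norm_integral_le_of_norm_le hint.integrableOn ?_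
    refine (ae_restrict_iff' hS).2 (Filter.Eventually.of_forall fun η hη => ?_)
    have h1 : 1 + (y - η) ^ 2 ≤ (1 + |y - η|) ^ 2 := by
      nlinarith [abs_nonneg (y - η), sq_abs (y - η)]
    have h2 : (1 + |y|) ^ N ≤ (1 + |y - η|) ^ N * (1 + |η|) ^ N := by
      rw [← mul_pow]
      exact pow_le_pow_left₀ (by positivity) (one_add_abs_le_mul y η) N
    calc ‖F (y - η) * m η‖
        ≤ (K * ((1 + |y - η|) ^ (N + 2))⁻¹) * (C * ((1 + |η|) ^ N)⁻¹) := by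
          rw [norm_mul]
          exact mul_le_mul (hK _) (hm η hη) (norm_nonneg _) (by positivity)
      _ = K * C * (((1 + |y - η|) ^ N * (1 + |η|) ^ N)⁻¹ * ((1 + |y - η|) ^ 2)⁻¹) := by
          rw [pow_add, mul_inv, mul_inv]; ring
      _ ≤ K * C * (((1 + |y|) ^ N)⁻¹ * (1 + (y - η) ^ 2)⁻¹) := by gcongr
      _ = A * (1 + (y - η) ^ 2)⁻¹ := by rw [hA]; ring
  refine hle.trans ((setIntegral_le_integral hint
    (Filter.Eventually.of_forall fun η => by positivity)).trans (le_of_eq ?_))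
  rw [integral_const_mul, integral_sub_left_eq_self (fun s : ℝ => (1 + s ^ 2)⁻¹),
    integral_univ_inv_one_add_sq, hA]
  ring

/-- A compactly supported function that vanishes near the origin can be divided by `-2πix` without
losing smoothness or enlarging its support. -/
theorem exists_eq_mul_of_notMem_tsupport (f : 𝓢(ℝ, ℂ)) (hf : HasCompactSupport f)
    (h0 : (0 : ℝ) ∉ tsupport f) :
    ∃ g : 𝓢(ℝ, ℂ), HasCompactSupport g ∧ (0 : ℝ) ∉ tsupport g ∧
      ∀ x : ℝ, (-2 * Real.pi * Complex.I * x) • g x = f x := by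
  let g₀ : ℝ → ℂ := fun x => f x * (-2 * Real.pi * Complex.I * x)⁻¹
  have hsub : tsupport g₀ ⊆ tsupport f := tsupport_mul_subset_left
  have hcs : HasCompactSupport g₀ := hf.mul_right
  have hne : ∀ x : ℝ, x ≠ 0 → (-2 * Real.pi * Complex.I * x : ℂ) ≠ 0 := fun x hx => by
    simp [Real.pi_ne_zero, hx]
  have hsm : ContDiff ℝ ∞ g₀ := by
    rw [contDiff_iff_contDiffAt]
    intro x
    by_cases hx : x ∈ tsupport f
    · have hx0 : x ≠ 0 := fun h => h0 (h ▸ hx)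
      refine (f.smooth ⊤).contDiffAt.mul (ContDiffAt.inv ?_ (hne x hx0))
      exact (contDiff_const.mul Complex.ofRealCLM.contDiff).contDiffAt
    · refine (contDiffAt_const (c := (0 : ℂ))).congr_of_eventuallyEq ?_
      exact notMem_tsupport_iff_eventuallyEq.1 fun h => hx (hsub h)
  refine ⟨hcs.toSchwartzMap hsm, hcs, fun h => h0 (hsub h), fun x => ?_⟩
  change (-2 * Real.pi * Complex.I * x : ℂ) * (f x * (-2 * Real.pi * Complex.I * x)⁻¹) = f x
  by_cases hx : x = 0
  · subst hx
    rw [image_eq_zero_of_notMem_tsupport h0]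
    simp
  · rw [mul_comm (f x), mul_inv_cancel_left₀ (hne x hx)]

theorem hasDerivAt_fourier_of_eq_mul {f g : 𝓢(ℝ, ℂ)}
    (h : ∀ x : ℝ, (-2 * Real.pi * Complex.I * x) • g x = f x) (w : ℝ) :
    HasDerivAt (𝓕ₛ g) (𝓕ₛ f w) w := by
  have hg : Integrable fun x : ℝ => x • g x := by
    have h1 := (g.integrable_pow_mul volume 1)
    refine (integrable_norm_iff ?_).1 ?_
    · exact (continuous_id.smul g.continuous).aestronglyMeasurable
    · simpa [norm_smul] using h1
  have := Real.hasDerivAt_fourier g.integrable hg w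
  simp_rw [h] at this
  exact this

/-- The functions `G n` are the successive derivatives on `[1, ∞)` of a symbol of order zero
`G 0`, with symbol bounds `C n`. -/
def IsSymbolSeq (C : ℕ → ℝ) (G : ℕ → ℝ → ℂ) : Prop :=
  ∀ (n : ℕ) (η : ℝ), 1 ≤ η → HasDerivAt (G n) (G (n + 1) η) η ∧ ‖G n η‖ ≤ C n * (η ^ n)⁻¹

theorem IsSymbolSeq.norm_le {C : ℕ → ℝ} {G : ℕ → ℝ → ℂ} (hG : IsSymbolSeq C G)
    (n : ℕ) {η : ℝ} (hη : 1 ≤ η) : ‖G n η‖ ≤ C n := by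
  have h1 := (hG n 1 le_rfl).2
  have h2 := (hG n η hη).2
  have hC : 0 ≤ C n := by simpa using (norm_nonneg _).trans h1
  exact h2.trans (mul_le_of_le_one_right hC (inv_le_one_of_one_le₀ (one_le_pow₀ hη)))

theorem IsSymbolSeq.integrableOn {C : ℕ → ℝ} {G : ℕ → ℝ → ℂ} (hG : IsSymbolSeq C G) (n : ℕ)
    (F : 𝓢(ℝ, ℂ)) (y : ℝ) : IntegrableOn (fun η => F (y - η) * G n η) (Set.Ioi 1) := by
  refine Integrable.mul_bdd (c := C n) (F.integrable.comp_sub_left y).integrableOn ?_ ?_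
  · refine ContinuousOn.aestronglyMeasurable (fun η hη => ?_) measurableSet_Ioi
    exact (hG n η (le_of_lt hη)).1.continuousAt.continuousWithinAt
  · refine (ae_restrict_iff' measurableSet_Ioi).2 (Filter.Eventually.of_forall fun η hη => ?_)
    exact hG.norm_le n (le_of_lt hη)

/-- If `g` is the quotient of `f` by `-2πix`, then `𝓕ₛ f` is the derivative of `𝓕ₛ g`, and
integrating by parts moves the derivative to the symbol. -/
theorem IsSymbolSeq.integral_by_parts {C : ℕ → ℝ} {G : ℕ → ℝ → ℂ} (hG : IsSymbolSeq C G) (n : ℕ)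
    {f g : 𝓢(ℝ, ℂ)} (h : ∀ x : ℝ, (-2 * Real.pi * Complex.I * x) • g x = f x) (y : ℝ) :
    ∫ η in Set.Ioi 1, 𝓕ₛ f (y - η) * G n η =
      𝓕ₛ g (y - 1) * G n 1 + ∫ η in Set.Ioi 1, 𝓕ₛ g (y - η) * G (n + 1) η := by
  have hder : ∀ η : ℝ, HasDerivAt (fun η => 𝓕ₛ g (y - η)) (-𝓕ₛ f (y - η)) η := fun η => by
    have := (hasDerivAt_fourier_of_eq_mul h (y - η)).scomp η ((hasDerivAt_id η).const_sub y)
    simpa [Function.comp_def] using this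
  have hinfty : Filter.Tendsto ((fun η => 𝓕ₛ g (y - η)) * G n) Filter.atTop (nhds 0) := by
    have h1 : Filter.Tendsto (fun η => 𝓕ₛ g (y - η)) Filter.atTop (nhds 0) := by
      have h2 : Filter.Tendsto (fun η : ℝ => y - η) Filter.atTop (Filter.cocompact ℝ) :=
        (Filter.tendsto_atBot_add_const_left _ y Filter.tendsto_neg_atTop_atBot).mono_right
          atBot_le_cocompact
      exact (zero_at_infty (𝓕ₛ g)).comp h2
    refine h1.zero_mul_isBoundedUnder_le ?_
    refine Filter.isBoundedUnder_of_eventually_le (a := C n) ?_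
    filter_upwards [Filter.eventually_ge_atTop 1] with η hη
    exact hG.norm_le n hη
  have hone : Filter.Tendsto ((fun η => 𝓕ₛ g (y - η)) * G n) (nhdsWithin 1 (Set.Ioi 1))
      (nhds (𝓕ₛ g (y - 1) * G n 1)) :=
    ((hder 1).continuousAt.mul (hG n 1 le_rfl).1.continuousAt).tendsto.mono_left
      nhdsWithin_le_nhds
  have key := integral_Ioi_mul_deriv_eq_deriv_mul (fun η _ => hder η)
    (fun η hη => (hG n η (le_of_lt hη)).1) (hG.integrableOn (n + 1) (𝓕ₛ g) y)
    (by simpa [IntegrableOn, Pi.mul_def] using (hG.integrableOn n (𝓕ₛ f) y).neg) hone hinfty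
  simp only [neg_mul, integral_neg] at key
  rw [key]
  ring

/-- Each integration by parts replaces `f` by its quotient by `-2πix` and gains one power of decay;
after `d` of them the symbol itself has the decay wanted, and convolution preserves it. -/
theorem exists_norm_integral_Ioi_le (C : ℕ → ℝ) (d : ℕ) : ∀ (n : ℕ) (f : 𝓢(ℝ, ℂ)),
    HasCompactSupport f → (0 : ℝ) ∉ tsupport f → ∃ K : ℝ, 0 ≤ K ∧ ∀ G, IsSymbolSeq C G →
      ∀ y, ‖∫ η in Set.Ioi 1, 𝓕ₛ f (y - η) * G n η‖ ≤ K * ((1 + |y|) ^ (n + d))⁻¹ := by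
  induction d with
  | zero =>
    intro n f _ _
    obtain ⟨K, hK0, hK⟩ := exists_norm_setIntegral_conv_le (𝓕ₛ f) n
    refine ⟨K * (2 ^ n * |C n|), by positivity, fun G hG y => ?_⟩
    refine hK (2 ^ n * |C n|) (G n) (Set.Ioi 1) (by positivity) measurableSet_Ioi
      (fun η hη => ?_) y
    have hη1 : 1 < η := hη
    refine (hG n η hη1.le).2.trans ?_
    have h1 : (1 + |η|) ^ n ≤ 2 ^ n * η ^ n := by
      rw [← mul_pow, abs_of_pos (by linarith)]
      exact pow_le_pow_left₀ (by linarith) (by linarith) n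
    have hp : 0 < η ^ n := by positivity
    calc C n * (η ^ n)⁻¹ ≤ |C n| * (η ^ n)⁻¹ := by gcongr; exact le_abs_self _
      _ = |C n| * (2 ^ n * (2 ^ n * η ^ n)⁻¹) := by field_simp
      _ ≤ |C n| * (2 ^ n * ((1 + |η|) ^ n)⁻¹) := by gcongr
      _ = 2 ^ n * |C n| * ((1 + |η|) ^ n)⁻¹ := by ring
  | succ d ih =>
    intro n f hf h0
    obtain ⟨g, hg, hg0, hfg⟩ := exists_eq_mul_of_notMem_tsupport f hf h0
    obtain ⟨K, hK0, hK⟩ := ih (n + 1) g hg hg0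
    obtain ⟨K', hK'0, hK'⟩ := exists_schwartz_decay (𝓕ₛ g) (n + 1 + d)
    refine ⟨K' * 2 ^ (n + 1 + d) * |C n| + K, by positivity, fun G hG y => ?_⟩
    rw [hG.integral_by_parts n hfg y, show n + (d + 1) = n + 1 + d by ring, add_mul]
    refine (norm_add_le _ _).trans (add_le_add ?_ (hK G hG y))
    have h1 : (1 + |y|) ^ (n + 1 + d) ≤ (1 + |y - 1|) ^ (n + 1 + d) * 2 ^ (n + 1 + d) := by
      rw [← mul_pow]
      refine pow_le_pow_left₀ (by positivity) ((one_add_abs_le_mul y 1).trans (le_of_eq ?_)) _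
      norm_num
    have hp : 0 < (1 + |y - 1|) ^ (n + 1 + d) := by positivity
    calc ‖𝓕ₛ g (y - 1) * G n 1‖ ≤ (K' * ((1 + |y - 1|) ^ (n + 1 + d))⁻¹) * |C n| := by
          rw [norm_mul]
          exact mul_le_mul (hK' _) ((hG.norm_le n le_rfl).trans (le_abs_self _)) (norm_nonneg _)
            (by positivity)
      _ = K' * 2 ^ (n + 1 + d) * |C n| *
            ((1 + |y - 1|) ^ (n + 1 + d) * 2 ^ (n + 1 + d))⁻¹ := by field_simp
      _ ≤ K' * 2 ^ (n + 1 + d) * |C n| * ((1 + |y|) ^ (n + 1 + d))⁻¹ := by gcongr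

/-- The pseudolocal estimate: the convolution of an even symbol of order zero with the Fourier
transform of a function supported away from the origin is rapidly decreasing, with constants that
depend on the symbol only through its symbol bounds. -/
theorem exists_norm_integral_conv_le (C : ℕ → ℝ) (N : ℕ) (f : 𝓢(ℝ, ℂ))
    (hf : HasCompactSupport f) (h0 : (0 : ℝ) ∉ tsupport f) :
    ∃ K : ℝ, 0 ≤ K ∧ ∀ (m : ℝ → ℂ) (G : ℕ → ℝ → ℂ), IsSymbolSeq C G → Measurable m →
      (∀ η, m (-η) = m η) → (∀ η, 1 ≤ η → m η = G 0 η) → (∀ η, ‖m η‖ ≤ C 0) →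
      ∀ y, ‖∫ η, 𝓕ₛ f (y - η) * m η‖ ≤ K * ((1 + |y|) ^ N)⁻¹ := by
  let neg : 𝓢(ℝ, ℂ) →L[ℂ] 𝓢(ℝ, ℂ) :=
    SchwartzMap.compCLMOfContinuousLinearEquiv ℂ (LinearIsometryEquiv.neg ℝ (E := ℝ))
  have hneg : ∀ (g : 𝓢(ℝ, ℂ)) (x : ℝ), neg g x = g (-x) := fun g x => rfl
  have hnegf : (neg f : ℝ → ℂ) = f ∘ (Homeomorph.neg ℝ) := rfl
  have hfn : HasCompactSupport (neg f) := by
    rw [hnegf]; exact hf.comp_homeomorph _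
  have h0n : (0 : ℝ) ∉ tsupport (neg f) := by
    rw [hnegf, tsupport_comp_eq_preimage]
    simpa using h0
  have hFneg : ∀ s, 𝓕ₛ (neg f) s = 𝓕ₛ f (-s) := fun s => by
    rw [SchwartzMap.fourier_coe, SchwartzMap.fourier_coe, Real.fourier_eq', Real.fourier_eq',
      ← integral_neg_eq_self]
    refine integral_congr_ae (Filter.Eventually.of_forall fun x => ?_)
    simp [hneg]
  obtain ⟨K₁, hK₁0, hK₁⟩ := exists_norm_integral_Ioi_le C N 0 f hf h0
  obtain ⟨K₂, hK₂0, hK₂⟩ := exists_norm_integral_Ioi_le C N 0 (neg f) hfn h0n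
  obtain ⟨K₃, hK₃0, hK₃⟩ := exists_norm_setIntegral_conv_le (𝓕ₛ f) N
  refine ⟨K₂ + K₃ * (2 ^ N * |C 0|) + K₁, by positivity, fun m G hG hm heven hmG hmC y => ?_⟩
  simp only [zero_add] at hK₁ hK₂
  have hint : Integrable fun η => 𝓕ₛ f (y - η) * m η :=
    Integrable.mul_bdd (c := C 0) ((𝓕ₛ f).integrable.comp_sub_left y) hm.aestronglyMeasurable
      (Filter.Eventually.of_forall hmC)
  have hright : ∫ η in Set.Ioi 1, 𝓕ₛ f (y - η) * m η = ∫ η in Set.Ioi 1, 𝓕ₛ f (y - η) * G 0 η :=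
    setIntegral_congr_fun measurableSet_Ioi fun η hη => by
      simp only [hmG η (le_of_lt hη)]
  -- The half-line `η < -1` is reflected to `η > 1`, which replaces `f` by `f (-·)`.
  have hleft : ∫ η in Set.Iic (-1), 𝓕ₛ f (y - η) * m η =
      ∫ η in Set.Ioi 1, 𝓕ₛ (neg f) (-y - η) * G 0 η := by
    rw [← integral_comp_neg_Ioi]
    refine setIntegral_congr_fun measurableSet_Ioi fun η hη => ?_
    simp only [heven, hmG η (le_of_lt hη), hFneg]
    ring_nf
  have hmid : ‖∫ η in Set.Ioc (-1) 1, 𝓕ₛ f (y - η) * m η‖ ≤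
      K₃ * (2 ^ N * |C 0|) * ((1 + |y|) ^ N)⁻¹ := by
    refine hK₃ _ m _ (by positivity) measurableSet_Ioc (fun η hη => ?_) y
    have h1 : (1 + |η|) ^ N ≤ 2 ^ N :=
      pow_le_pow_left₀ (by positivity) (by linarith [abs_le.2 ⟨hη.1.le, hη.2⟩]) N
    have h2 : (0 : ℝ) < (1 + |η|) ^ N := by positivity
    rw [← div_eq_mul_inv, le_div_iff₀ h2, mul_comm]
    exact mul_le_mul h1 ((hmC η).trans (le_abs_self _)) (norm_nonneg _) (by positivity)
  have hsplit : ∫ η, 𝓕ₛ f (y - η) * m η = (∫ η in Set.Iic (-1), 𝓕ₛ f (y - η) * m η) +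
      (∫ η in Set.Ioc (-1) 1, 𝓕ₛ f (y - η) * m η) + ∫ η in Set.Ioi 1, 𝓕ₛ f (y - η) * m η := by
    rw [← setIntegral_union (Set.Iic_disjoint_Ioc le_rfl) measurableSet_Ioc hint.integrableOn
      hint.integrableOn, Set.Iic_union_Ioc_eq_Iic (by norm_num),
      ← setIntegral_union (Set.Iic_disjoint_Ioi le_rfl) measurableSet_Ioi hint.integrableOn
      hint.integrableOn, Set.Iic_union_Ioi, setIntegral_univ]
  rw [hsplit, hleft, hright, add_mul, add_mul]
  refine (norm_add₃_le).trans (add_le_add (add_le_add ?_ hmid) (hK₁ G hG y))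
  simpa using hK₂ G hG (-y)

/-! ### The holomorphic extension of the dispersion relation -/

theorem aCoeff_pos {α : ℝ} (hα : 2 ≤ α) (hα' : α < 3) : 0 < aCoeff α := by
  rw [aCoeff, neg_pos]
  exact Real.cos_neg_of_pi_div_two_lt_of_lt (by nlinarith [Real.pi_pos])
    (by nlinarith [Real.pi_pos])

/-- The sector `|arg z| < π/6`, described by the sine of the argument. -/
theorem abs_arg_lt_pi_div_six {z : ℂ} (hz : 0 < z.re) (h : 2 * |z.im| < ‖z‖) :
    |z.arg| < Real.pi / 6 := by
  have h0 : 0 < ‖z‖ := by linarith [abs_nonneg z.im]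
  have h1 : |z.im / ‖z‖| < 1 / 2 := by
    rw [abs_div, abs_norm, div_lt_iff₀ h0]; linarith
  have hpi := Real.pi_pos
  rw [abs_lt] at h1
  rw [Complex.arg_of_re_nonneg hz.le, abs_lt]
  constructor
  · rw [Real.lt_arcsin_iff_sin_lt' ⟨by linarith, by linarith⟩, Real.sin_neg, Real.sin_pi_div_six]
    linarith
  · rw [Real.arcsin_lt_iff_lt_sin' ⟨by linarith, by linarith⟩, Real.sin_pi_div_six]
    linarith

/-- For `α ≤ 3` the power `z ^ α` maps the sector `|arg z| < π/6` into the right half-plane, so that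
`1 + a z ^ α` stays away from the branch cut of the square root. -/
theorem re_cpow_pos {α : ℝ} (hα : 0 ≤ α) (hα' : α ≤ 3) {z : ℂ} (hz : 0 < z.re)
    (h : 2 * |z.im| < ‖z‖) : 0 < (z ^ (α : ℂ)).re := by
  have hz0 : z ≠ 0 := fun h0 => by simp [h0] at hz
  have h1 := abs_arg_lt_pi_div_six hz h
  have h2 : |z.arg * α| < Real.pi / 2 := by
    rw [abs_mul, abs_of_nonneg hα]
    nlinarith [abs_nonneg z.arg]
  rw [Complex.cpow_def_of_ne_zero hz0, Complex.exp_re, Complex.im_mul_ofReal, Complex.log_im]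
  rw [abs_lt] at h2
  exact mul_pos (Real.exp_pos _) (Real.cos_pos_of_mem_Ioo h2)

theorem mul_norm_le_norm_one_add {a : ℝ} (ha : 0 ≤ a) {w : ℂ} (hw : 0 ≤ w.re) :
    a * ‖w‖ ≤ ‖1 + a * w‖ := by
  rw [show a * ‖w‖ = ‖(a : ℂ) * w‖ by rw [norm_mul, Complex.norm_of_nonneg ha]]
  rw [← sq_le_sq₀ (norm_nonneg _) (norm_nonneg _), Complex.sq_norm, Complex.sq_norm,
    Complex.normSq_apply, Complex.normSq_apply]
  simp only [Complex.add_re, Complex.one_re, Complex.add_im, Complex.one_im, zero_add,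
    Complex.re_ofReal_mul]
  nlinarith [mul_nonneg ha hw]

/-- The holomorphic extension of `h_α` from the positive half-line to a sector about it, given by
principal branches of the powers. -/
def hHolo (α : ℝ) (z : ℂ) : ℂ := z / (1 + aCoeff α * z ^ (α : ℂ)) ^ (1 / 2 : ℂ)

section Sector

variable {α : ℝ} (hα : 2 ≤ α) (hα' : α < 3) {z : ℂ} (hz : 0 < z.re) (hz' : 2 * |z.im| < ‖z‖)

include hα hα' hz hz'

theorem one_add_mul_cpow_mem_slitPlane : 1 + aCoeff α * z ^ (α : ℂ) ∈ Complex.slitPlane := by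
  refine Or.inl ?_
  have h1 := re_cpow_pos (by linarith) hα'.le hz hz'
  rw [Complex.add_re, Complex.one_re, Complex.re_ofReal_mul]
  have := mul_pos (aCoeff_pos hα hα') h1
  linarith

theorem hHolo_ne_zero : hHolo α z ≠ 0 := by
  have hs := one_add_mul_cpow_mem_slitPlane hα hα' hz hz'
  refine div_ne_zero (fun h0 => by simp [h0] at hz) ?_
  rw [Complex.cpow_ne_zero_iff]
  exact Or.inl (Complex.slitPlane_ne_zero hs)

theorem differentiableAt_hHolo : DifferentiableAt ℂ (hHolo α) z := by
  have hs := one_add_mul_cpow_mem_slitPlane hα hα' hz hz'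
  refine differentiableAt_id.div ?_ ?_
  · refine DifferentiableAt.cpow_const ?_ hs
    refine (DifferentiableAt.const_mul ?_ _).const_add _
    exact differentiableAt_id.cpow_const (Or.inl hz)
  · rw [Complex.cpow_ne_zero_iff]
    exact Or.inl (Complex.slitPlane_ne_zero hs)

/-- Boundedness of `h_α` on the sector away from the origin: `|h_α(z)|² ≤ |z|² / (a |z|^α)`, and
`|z|² ≤ |z|^α` because `α ≥ 2`. -/
theorem norm_hHolo_le (h1 : 1 ≤ ‖z‖) : ‖hHolo α z‖ ≤ √(1 / aCoeff α) := by
  have ha := aCoeff_pos hα hα'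
  refine Real.le_sqrt_of_sq_le ?_
  have hw := mul_norm_le_norm_one_add ha.le (re_cpow_pos (by linarith) hα'.le hz hz').le
  rw [Complex.norm_cpow_real] at hw
  have hsq : ‖(1 + aCoeff α * z ^ (α : ℂ)) ^ (1 / 2 : ℂ)‖ ^ 2 = ‖1 + aCoeff α * z ^ (α : ℂ)‖ := by
    rw [← norm_pow, one_div]
    exact congrArg _ (Complex.cpow_nat_inv_pow _ two_ne_zero)
  have hpow : ‖z‖ ^ 2 ≤ ‖z‖ ^ α := by
    rw [← Real.rpow_natCast]
    exact Real.rpow_le_rpow_of_exponent_le h1 (by exact_mod_cast hα)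
  have h2 : 0 < ‖z‖ ^ 2 := by positivity
  rw [hHolo, norm_div, div_pow, hsq]
  calc ‖z‖ ^ 2 / ‖1 + aCoeff α * z ^ (α : ℂ)‖ ≤ ‖z‖ ^ 2 / (aCoeff α * ‖z‖ ^ 2) := by
        refine div_le_div_of_nonneg_left h2.le (by positivity) (le_trans ?_ hw)
        gcongr
    _ = 1 / aCoeff α := by field_simp

end Sector

theorem hHolo_ofReal {α : ℝ} (hα : 2 ≤ α) (hα' : α < 3) {ξ : ℝ} (hξ : 0 < ξ) :
    hHolo α ξ = hSymbol α ξ := by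
  have ha := aCoeff_pos hα hα'
  have h0 : 0 ≤ 1 + aCoeff α * ξ ^ α := by positivity
  rw [hHolo, hSymbol, abs_of_pos hξ, Real.sqrt_eq_rpow, Complex.ofReal_div,
    Complex.ofReal_cpow h0]
  push_cast [Complex.ofReal_cpow hξ.le]
  rfl

theorem hSymbol_nonneg (α ξ : ℝ) : 0 ≤ hSymbol α ξ := by
  unfold hSymbol; positivity

theorem hSymbol_abs (α ξ : ℝ) : hSymbol α |ξ| = hSymbol α ξ := by
  simp [hSymbol]

theorem hSymbol_le {α : ℝ} (hα : 2 ≤ α) (hα' : α < 3) (ξ : ℝ) :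
    hSymbol α ξ ≤ 1 + √(1 / aCoeff α) := by
  have ha := aCoeff_pos hα hα'
  rcases le_total |ξ| 1 with h | h
  · have : hSymbol α ξ ≤ 1 := by
      refine (div_le_self (abs_nonneg _) ?_).trans h
      rw [Real.one_le_sqrt]
      have : 0 ≤ aCoeff α * |ξ| ^ α := by positivity
      linarith
    linarith [Real.sqrt_nonneg (1 / aCoeff α)]
  · have h0 : 0 < |ξ| := by linarith
    have := norm_hHolo_le hα hα' (z := (|ξ| : ℝ)) (by simpa using h0)
      (by simpa using h0) (by simpa using h)
    rw [hHolo_ofReal hα hα' h0, hSymbol_abs, Complex.norm_real] at this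
    linarith [le_abs_self (hSymbol α ξ), Real.norm_eq_abs (hSymbol α ξ)]

/-! ### Symbol bounds for the spatial Fourier transforms -/

theorem norm_cos_le_exp (w : ℂ) : ‖Complex.cos w‖ ≤ Real.exp ‖w‖ := by
  have h1 := Complex.norm_exp_le_exp_norm (w * Complex.I)
  have h2 := Complex.norm_exp_le_exp_norm (-w * Complex.I)
  simp only [norm_mul, norm_neg, Complex.norm_I, mul_one] at h1 h2
  rw [Complex.cos, norm_div, Complex.norm_two]
  linarith [norm_add_le (Complex.exp (w * Complex.I)) (Complex.exp (-w * Complex.I))]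

theorem norm_sin_le_mul_exp (w : ℂ) : ‖Complex.sin w‖ ≤ ‖w‖ * Real.exp ‖w‖ := by
  have h1 := Complex.norm_exp_sub_sum_le_norm_mul_exp (-w * Complex.I) 1
  have h2 := Complex.norm_exp_sub_sum_le_norm_mul_exp (w * Complex.I) 1
  simp only [Finset.sum_range_one, pow_zero, Nat.factorial_zero, Nat.cast_one, div_one, pow_one,
    norm_mul, norm_neg, Complex.norm_I, mul_one] at h1 h2
  have h3 : Complex.sin w = ((Complex.exp (-w * Complex.I) - 1) -
      (Complex.exp (w * Complex.I) - 1)) * Complex.I / 2 := by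
    rw [Complex.sin]; ring
  rw [h3, norm_div, norm_mul, Complex.norm_I, Complex.norm_two, mul_one]
  linarith [norm_sub_le (Complex.exp (-w * Complex.I) - 1) (Complex.exp (w * Complex.I) - 1)]

/-- The holomorphic extension of `η ↦ fundSymbol α j t (2πη)`, `t > 0`, from the positive half-line
to a sector about it. -/
def fundHolo (α : ℝ) (j : Fin 2) (t : ℝ) (z : ℂ) : ℂ :=
  if j = 0 then Complex.cos (t * hHolo α (2 * Real.pi * z))
  else Complex.sin (t * hHolo α (2 * Real.pi * z)) / hHolo α (2 * Real.pi * z)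

theorem fundHolo_ofReal {α : ℝ} (hα : 2 ≤ α) (hα' : α < 3) (j : Fin 2) {t : ℝ} (ht : 0 < t)
    {η : ℝ} (hη : 0 < η) : fundHolo α j t η = fundSymbol α j t (2 * Real.pi * η) := by
  have h := hHolo_ofReal hα hα' (ξ := 2 * Real.pi * η) (by have := Real.pi_pos; positivity)
  push_cast at h
  fin_cases j
  · simp [fundHolo, fundSymbol, ht, h, mul_comm (t : ℂ)]
  · simp [fundHolo, fundSymbol, ht, h, mul_comm (t : ℂ)]

section Disc

variable {η : ℝ} (hη : 1 ≤ η) {z : ℂ} (hz : z ∈ Metric.closedBall (η : ℂ) (η / 4))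

include hη hz

/-- The disc of radius `η / 4` about `η ≥ 1`, scaled by `2π`, lies in the sector `|arg z| < π/6` and
outside the open unit disc. -/
theorem mem_sector_of_mem_closedBall : 0 < (2 * Real.pi * z).re ∧
    2 * |(2 * Real.pi * z).im| < ‖2 * Real.pi * z‖ ∧ 1 ≤ ‖2 * Real.pi * z‖ := by
  rw [Metric.mem_closedBall, Complex.dist_eq] at hz
  have h1 := (Complex.abs_re_le_norm _).trans hz
  have h2 := (Complex.abs_im_le_norm _).trans hz
  simp only [Complex.sub_re, Complex.ofReal_re, Complex.sub_im, Complex.ofReal_im,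
    sub_zero] at h1 h2
  have h3 := (abs_le.1 h1).1
  have h4 := (le_abs_self _).trans (Complex.abs_re_le_norm z)
  have hpi := Real.pi_gt_three
  have hc : (2 * Real.pi * z : ℂ) = ((2 * Real.pi : ℝ) : ℂ) * z := by push_cast; ring
  rw [hc, Complex.re_ofReal_mul, Complex.im_ofReal_mul, norm_mul, Complex.norm_of_nonneg
    (by positivity), abs_mul, abs_of_pos (by positivity : (0 : ℝ) < 2 * Real.pi)]
  refine ⟨mul_pos (by positivity) (by linarith), ?_, by nlinarith⟩
  nlinarith

variable {α : ℝ} (hα : 2 ≤ α) (hα' : α < 3)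

include hα hα'

theorem differentiableAt_fundHolo (j : Fin 2) (t : ℝ) :
    DifferentiableAt ℂ (fundHolo α j t) z := by
  obtain ⟨h1, h2, -⟩ := mem_sector_of_mem_closedBall hη hz
  have hd : DifferentiableAt ℂ (fun z => hHolo α (2 * Real.pi * z)) z :=
    (differentiableAt_hHolo hα hα' h1 h2).comp z (differentiableAt_id.const_mul _)
  unfold fundHolo
  split_ifs
  · exact (hd.const_mul _).ccos
  · exact (hd.const_mul _).csin.div hd (hHolo_ne_zero hα hα' h1 h2)

theorem norm_fundHolo_le (j : Fin 2) {t T : ℝ} (ht : 0 < t) (htT : t ≤ T) :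
    ‖fundHolo α j t z‖ ≤ (1 + T) * Real.exp (T * √(1 / aCoeff α)) := by
  obtain ⟨h1, h2, h3⟩ := mem_sector_of_mem_closedBall hη hz
  have hb := norm_hHolo_le hα hα' h1 h2 h3
  have h0 := hHolo_ne_zero hα hα' h1 h2
  have hT : 0 ≤ T := ht.le.trans htT
  have hn : ‖(t : ℂ) * hHolo α (2 * Real.pi * z)‖ = t * ‖hHolo α (2 * Real.pi * z)‖ := by
    rw [norm_mul, Complex.norm_of_nonneg ht.le]
  have he : Real.exp ‖(t : ℂ) * hHolo α (2 * Real.pi * z)‖ ≤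
      Real.exp (T * √(1 / aCoeff α)) := by
    rw [hn]
    exact Real.exp_le_exp.2 (mul_le_mul htT hb (norm_nonneg _) hT)
  unfold fundHolo
  split_ifs
  · refine (norm_cos_le_exp _).trans (he.trans ?_)
    exact le_mul_of_one_le_left (Real.exp_pos _).le (by linarith)
  · rw [norm_div, div_le_iff₀ (norm_pos_iff.2 h0)]
    refine (norm_sin_le_mul_exp _).trans ?_
    calc _ ≤ ((1 + T) * ‖hHolo α (2 * Real.pi * z)‖) * Real.exp (T * √(1 / aCoeff α)) := by
          refine mul_le_mul ?_ he (Real.exp_pos _).le (by positivity)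
          rw [hn]; gcongr; linarith
      _ = _ := by ring

end Disc

/-- Cauchy's estimates on the discs of radius `η / 4` about `η` give symbol bounds for
`fundSymbol`, uniformly for `t` in a bounded interval. -/
theorem exists_isSymbolSeq_fundSymbol {α : ℝ} (hα : 2 ≤ α) (hα' : α < 3) (j : Fin 2) (T : ℝ) :
    ∃ C : ℕ → ℝ, ∀ t : ℝ, 0 < t → t ≤ T → 1 + t ≤ C 0 ∧
      IsSymbolSeq C fun n η => iteratedDeriv n (fundHolo α j t) η := by
  refine ⟨fun n => n.factorial * ((1 + T) * Real.exp (T * √(1 / aCoeff α))) * 4 ^ n,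
    fun t ht htT => ⟨?_, fun n η hη => ⟨?_, ?_⟩⟩⟩
  · have h1 : 1 ≤ Real.exp (T * √(1 / aCoeff α)) :=
      Real.one_le_exp (mul_nonneg (by linarith) (Real.sqrt_nonneg _))
    simp only [Nat.factorial_zero, Nat.cast_one, one_mul, pow_zero, mul_one]
    nlinarith
  · have hr : 0 < η / 4 := by linarith
    have hd : DifferentiableOn ℂ (fundHolo α j t) (Metric.ball (η : ℂ) (η / 4)) := fun z hz =>
      (differentiableAt_fundHolo hη (Metric.ball_subset_closedBall hz) hα hα' j
        t).differentiableWithinAt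
    have han := (hd.analyticAt (Metric.ball_mem_nhds (η : ℂ) hr)).iterated_deriv n
    rw [← iteratedDeriv_eq_iterate] at han
    have := han.differentiableAt.hasDerivAt.comp_ofReal
    rwa [← iteratedDeriv_succ] at this
  · have hr : 0 < η / 4 := by linarith
    have hd : DiffContOnCl ℂ (fundHolo α j t) (Metric.ball (η : ℂ) (η / 4)) := by
      refine DifferentiableOn.diffContOnCl fun z hz => ?_
      exact (differentiableAt_fundHolo hη (Metric.closure_ball_subset_closedBall hz) hα hα' j
        t).differentiableWithinAt
    refine (Complex.norm_iteratedDeriv_le_of_forall_mem_sphere_norm_le n hr hd fun z hz =>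
      norm_fundHolo_le hη (Metric.sphere_subset_closedBall hz) hα hα' j ht htT).trans
      (le_of_eq ?_)
    rw [div_pow]
    field_simp

/-! ### Product cut-offs and the localized Fourier transform -/

/-- The test function `(x, t) ↦ χ x * ψ t` on the upper half-plane. -/
def prodTest (χ ψ : 𝓢(ℝ, ℂ)) (hχ : HasCompactSupport χ) (hψ : HasCompactSupport ψ)
    (hψ0 : tsupport ψ ⊆ Set.Ioi 0) : 𝓓(upperHalf, ℂ) :=
  have hsub : tsupport (fun z : ℝ × ℝ => χ z.1 * ψ z.2) ⊆ tsupport χ ×ˢ tsupport ψ := by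
    refine closure_minimal (fun z hz => ?_)
      ((isClosed_tsupport χ).prod (isClosed_tsupport ψ))
    exact ⟨subset_tsupport _ (left_ne_zero_of_mul hz), subset_tsupport _ (right_ne_zero_of_mul hz)⟩
  { toFun := fun z => χ z.1 * ψ z.2
    contDiff' := ((χ.smooth ⊤).comp contDiff_fst).mul ((ψ.smooth ⊤).comp contDiff_snd)
    hasCompactSupport' := (hχ.prod hψ).of_isClosed_subset (isClosed_tsupport _) hsub
    tsupport_subset' := hsub.trans fun _ hz => hψ0 hz.2 }

/-- On complex test functions the restriction of a tempered distribution is given by the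
distribution itself: the splitting into real and imaginary parts is undone by linearity. -/
theorem exists_toSchwartz_evalComplex {E : Type*} [NormedAddCommGroup E] [NormedSpace ℝ E]
    {Ω : Opens E} (T : 𝓢'(E, ℂ)) (φ : 𝓓(Ω, ℂ)) :
    ∃ Φ : 𝓢(E, ℂ), (∀ z, Φ z = φ z) ∧ evalComplex (restrict Ω T) φ = T Φ := by
  refine ⟨toSchwartz (TestFunction.postcompCLM Complex.reCLM φ) +
    Complex.I • toSchwartz (TestFunction.postcompCLM Complex.imCLM φ), fun z => ?_, ?_⟩
  · simp [mul_comm Complex.I, Complex.re_add_im]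
  · rw [evalComplex, map_add, map_smul]
    rfl

/-- The Fourier transform of the localized fundamental solution, as an iterated integral. -/
theorem fourierCutoff_prodTest (α : ℝ) (j : Fin 2) {χ ψ : 𝓢(ℝ, ℂ)} (hχ : HasCompactSupport χ)
    (hψ : HasCompactSupport ψ) (hψ0 : tsupport ψ ⊆ Set.Ioi 0) (ξ τ : ℝ) :
    fourierCutoff (fundSolutionPlus α j) (prodTest χ ψ hχ hψ hψ0) (ξ, τ) =
      ∫ t, ψ t * Complex.exp (-Complex.I * (t * τ : ℝ)) *
        ∫ η, 𝓕ₛ χ (ξ / (2 * Real.pi) - η) * (fundSymbol α j t (2 * Real.pi * η) : ℂ) := by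
  obtain ⟨Φ, hΦ, hT⟩ := exists_toSchwartz_evalComplex (fundSolution α j)
    (modulate (prodTest χ ψ hχ hψ hψ0) (ξ, τ))
  have hΦ' : ∀ z : ℝ × ℝ, Φ z = χ z.1 * ψ z.2 *
      Complex.exp (-Complex.I * ((z.1 * ξ + z.2 * τ : ℝ) : ℂ)) := hΦ
  have hpi : (Real.pi : ℂ) ≠ 0 := by exact_mod_cast Real.pi_ne_zero
  rw [fourierCutoff, fundSolutionPlus, hT, fundSolution_apply]
  refine integral_congr_ae (Filter.Eventually.of_forall fun t => ?_)
  simp only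
  rw [fundSolutionAt_apply, ← integral_const_mul]
  refine integral_congr_ae (Filter.Eventually.of_forall fun η => ?_)
  simp only
  rw [← mul_assoc]
  congr 1
  rw [SchwartzMap.fourierInv_coe, SchwartzMap.fourier_coe, Real.fourierInv_eq', Real.fourier_eq',
    ← integral_const_mul]
  refine integral_congr_ae (Filter.Eventually.of_forall fun x => ?_)
  simp only [slice_apply, hΦ', smul_eq_mul]
  have h1 : Complex.exp ((2 * Real.pi * inner ℝ x η : ℝ) * Complex.I) *
      Complex.exp (-Complex.I * ((x * ξ + t * τ : ℝ) : ℂ)) =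
      Complex.exp (-Complex.I * (t * τ : ℝ)) *
      Complex.exp ((-2 * Real.pi * inner ℝ x (ξ / (2 * Real.pi) - η) : ℝ) * Complex.I) := by
    rw [← Complex.exp_add, ← Complex.exp_add]
    congr 1
    simp only [RCLike.inner_apply, conj_trivial]
    push_cast
    field_simp
    ring
  linear_combination (χ x * ψ t) * h1

/-! ### Decay in the spatial frequency -/

theorem norm_exp_neg_I_mul (s : ℝ) : ‖Complex.exp (-Complex.I * (s : ℂ))‖ = 1 := by
  rw [show -Complex.I * (s : ℂ) = ((-s : ℝ) : ℂ) * Complex.I by push_cast; ring,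
    Complex.norm_exp_ofReal_mul_I]

theorem one_add_abs_le_two_pi_mul (s : ℝ) : 1 + |s| ≤ 2 * Real.pi * (1 + |s / (2 * Real.pi)|) := by
  have hpi := Real.pi_gt_three
  rw [abs_div, abs_of_pos (by positivity : (0 : ℝ) < 2 * Real.pi), mul_add,
    mul_div_cancel₀ _ (by positivity)]
  linarith

theorem inv_pow_le_of_le_mul {a b c : ℝ} (ha : 0 < a) (hb : 0 < b) (hc : 0 < c) (h : a ≤ c * b)
    (N : ℕ) : (b ^ N)⁻¹ ≤ c ^ N * (a ^ N)⁻¹ := by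
  have h1 : a ^ N ≤ c ^ N * b ^ N := by
    rw [← mul_pow]; exact pow_le_pow_left₀ ha.le h N
  rw [← div_eq_mul_inv, inv_le_comm₀ (by positivity) (by positivity), inv_div,
    div_le_iff₀ (by positivity)]
  linarith

/-- Away from `x = 0` the localized Fourier transform decreases rapidly in `ξ`. -/
theorem exists_fourierCutoff_le_of_notMem {α : ℝ} (hα : 2 ≤ α) (hα' : α < 3) (j : Fin 2)
    {χ ψ : 𝓢(ℝ, ℂ)} (hχ : HasCompactSupport χ) (hψ : HasCompactSupport ψ)
    (hψ0 : tsupport ψ ⊆ Set.Ioi 0) (hχ0 : (0 : ℝ) ∉ tsupport χ) (N : ℕ) :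
    ∃ K : ℝ, 0 ≤ K ∧ ∀ ξ τ : ℝ,
      ‖fourierCutoff (fundSolutionPlus α j) (prodTest χ ψ hχ hψ hψ0) (ξ, τ)‖ ≤
        K * ((1 + |ξ|) ^ N)⁻¹ := by
  obtain ⟨T, hT⟩ := hψ.isCompact.isBounded.exists_norm_le
  obtain ⟨C, hC⟩ := exists_isSymbolSeq_fundSymbol hα hα' j T
  obtain ⟨K, hK0, hK⟩ := exists_norm_integral_conv_le C N χ hχ hχ0
  have hpi := Real.pi_pos
  refine ⟨(∫ t, ‖ψ t‖) * (K * (2 * Real.pi) ^ N), by positivity, fun ξ τ => ?_⟩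
  rw [fourierCutoff_prodTest, mul_assoc, ← integral_mul_const]
  refine norm_integral_le_of_norm_le (ψ.integrable.norm.mul_const _)
    (Filter.Eventually.of_forall fun t => ?_)
  rw [norm_mul, norm_mul, norm_exp_neg_I_mul, mul_one]
  by_cases ht : t ∈ tsupport ψ
  · refine mul_le_mul_of_nonneg_left ?_ (norm_nonneg _)
    have ht0 : 0 < t := hψ0 ht
    obtain ⟨h1, h2⟩ := hC t ht0 ((le_abs_self t).trans (hT t ht))
    refine (hK _ _ h2 ((measurable_fundSymbol_scaled α j).comp measurable_prodMk_left)
      (fun η => ?_) (fun η hη => ?_) (fun η => ?_) _).trans ?_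
    · have he : hSymbol α (2 * Real.pi * -η) = hSymbol α (2 * Real.pi * η) := by
        rw [← hSymbol_abs, ← hSymbol_abs α (2 * Real.pi * η), mul_neg, abs_neg]
      fin_cases j <;> simp only [fundSymbol, comp_apply, he]
    · simp only [comp_apply, iteratedDeriv_zero]
      exact (fundHolo_ofReal hα hα' j ht0 (by linarith)).symm
    · rw [comp_apply, Complex.norm_real]
      refine (abs_fundSymbol_le α j t _).trans ?_
      rwa [abs_of_pos ht0]
    · rw [mul_assoc]
      exact mul_le_mul_of_nonneg_left (inv_pow_le_of_le_mul (by positivity) (by positivity)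
        (by positivity) (one_add_abs_le_two_pi_mul ξ) N) hK0
  · rw [image_eq_zero_of_notMem_tsupport ht]
    simp

/-! ### Decay in the time frequency -/

/-- A bounded shift of the frequency does not affect the rapid decrease. The argument `σ / 2π`
translates an angular frequency into the normalization of `𝓕`. -/
theorem exists_schwartz_decay_near (F : 𝓢(ℝ, ℂ)) (N : ℕ) {B : ℝ} (hB : 0 ≤ B) :
    ∃ K : ℝ, 0 ≤ K ∧ ∀ σ τ : ℝ, |τ - σ| ≤ B →
      ‖F (σ / (2 * Real.pi))‖ ≤ K * ((1 + |τ|) ^ N)⁻¹ := by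
  obtain ⟨K, hK0, hK⟩ := exists_schwartz_decay F N
  have hpi := Real.pi_pos
  refine ⟨K * ((1 + B) * (2 * Real.pi)) ^ N, by positivity, fun σ τ h => (hK _).trans ?_⟩
  rw [mul_assoc]
  refine mul_le_mul_of_nonneg_left (inv_pow_le_of_le_mul (by positivity) (by positivity)
    (by positivity) ?_ N) hK0
  refine (one_add_abs_le_mul τ σ).trans ?_
  rw [mul_assoc]
  exact mul_le_mul (by linarith) (one_add_abs_le_two_pi_mul σ) (by positivity) (by positivity)

theorem fourier_div_two_pi (ψ : 𝓢(ℝ, ℂ)) (s : ℝ) :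
    𝓕ₛ ψ (s / (2 * Real.pi)) = ∫ t, ψ t * Complex.exp (-Complex.I * (t * s : ℝ)) := by
  have hpi : (Real.pi : ℂ) ≠ 0 := by exact_mod_cast Real.pi_ne_zero
  rw [SchwartzMap.fourier_coe, Real.fourier_eq']
  refine integral_congr_ae (Filter.Eventually.of_forall fun t => ?_)
  simp only [smul_eq_mul, RCLike.inner_apply, conj_trivial]
  rw [mul_comm]
  congr 2
  push_cast
  field_simp

theorem integrable_mul_exp_neg_I (ψ : 𝓢(ℝ, ℂ)) (s : ℝ) :
    Integrable fun t => ψ t * Complex.exp (-Complex.I * (t * s : ℝ)) := by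
  refine Integrable.mul_bdd (c := 1) ψ.integrable ?_ (Filter.Eventually.of_forall fun t => ?_)
  · exact (by fun_prop : Continuous fun t : ℝ =>
      Complex.exp (-Complex.I * (t * s : ℝ))).aestronglyMeasurable
  · rw [norm_exp_neg_I_mul]

theorem integral_mul_exp_mul_cos (ψ : 𝓢(ℝ, ℂ)) (τ h : ℝ) :
    ∫ t, ψ t * Complex.exp (-Complex.I * (t * τ : ℝ)) * (Real.cos (h * t) : ℂ) =
      (𝓕ₛ ψ ((τ - h) / (2 * Real.pi)) + 𝓕ₛ ψ ((τ + h) / (2 * Real.pi))) / 2 := by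
  rw [fourier_div_two_pi, fourier_div_two_pi,
    ← integral_add (integrable_mul_exp_neg_I ψ _) (integrable_mul_exp_neg_I ψ _),
    ← integral_div]
  refine integral_congr_ae (Filter.Eventually.of_forall fun t => ?_)
  simp only [Complex.ofReal_cos, Complex.cos]
  have h1 : Complex.exp (-Complex.I * (t * (τ - h) : ℝ)) =
      Complex.exp (-Complex.I * (t * τ : ℝ)) * Complex.exp ((h * t : ℝ) * Complex.I) := by
    rw [← Complex.exp_add]; congr 1; push_cast; ring
  have h2 : Complex.exp (-Complex.I * (t * (τ + h) : ℝ)) =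
      Complex.exp (-Complex.I * (t * τ : ℝ)) * Complex.exp (-(h * t : ℝ) * Complex.I) := by
    rw [← Complex.exp_add]; congr 1; push_cast; ring
  rw [h1, h2]
  ring

theorem integral_mul_exp_mul_sin (ψ : 𝓢(ℝ, ℂ)) (τ h : ℝ) :
    ∫ t, ψ t * Complex.exp (-Complex.I * (t * τ : ℝ)) * (Real.sin (h * t) : ℂ) =
      (𝓕ₛ ψ ((τ + h) / (2 * Real.pi)) - 𝓕ₛ ψ ((τ - h) / (2 * Real.pi))) * Complex.I / 2 := by
  rw [fourier_div_two_pi, fourier_div_two_pi,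
    ← integral_sub (integrable_mul_exp_neg_I ψ _) (integrable_mul_exp_neg_I ψ _),
    ← integral_mul_const, ← integral_div]
  refine integral_congr_ae (Filter.Eventually.of_forall fun t => ?_)
  simp only [Complex.ofReal_sin, Complex.sin]
  have h1 : Complex.exp (-Complex.I * (t * (τ - h) : ℝ)) =
      Complex.exp (-Complex.I * (t * τ : ℝ)) * Complex.exp ((h * t : ℝ) * Complex.I) := by
    rw [← Complex.exp_add]; congr 1; push_cast; ring
  have h2 : Complex.exp (-Complex.I * (t * (τ + h) : ℝ)) =
      Complex.exp (-Complex.I * (t * τ : ℝ)) * Complex.exp (-(h * t : ℝ) * Complex.I) := by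
    rw [← Complex.exp_add]; congr 1; push_cast; ring
  rw [h1, h2]
  ring

/-- The Fourier transform in time of the localized symbol decreases rapidly in `τ`, uniformly in
the spatial frequency `ξ`, because the frequencies `± h_α(ξ)` are bounded. -/
theorem exists_norm_integral_time_le {α : ℝ} (hα : 2 ≤ α) (hα' : α < 3) (j : Fin 2)
    {ψ : 𝓢(ℝ, ℂ)} (hψ0 : tsupport ψ ⊆ Set.Ioi 0) (N : ℕ) :
    ∃ K : ℝ, 0 ≤ K ∧ ∀ ξ τ : ℝ,
      ‖∫ t, ψ t * Complex.exp (-Complex.I * (t * τ : ℝ)) * (fundSymbol α j t ξ : ℂ)‖ ≤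
        K * ((1 + |τ|) ^ N)⁻¹ := by
  have hB : 0 ≤ 1 + √(1 / aCoeff α) := by positivity
  obtain ⟨K, hK0, hK⟩ := exists_schwartz_decay_near (𝓕ₛ ψ) N hB
  obtain ⟨K', hK'0, hK'⟩ := exists_schwartz_decay_near (SchwartzMap.derivCLM ℂ ℂ (𝓕ₛ ψ)) N hB
  have hcongr : ∀ (u : ℝ → ℂ) (v w : ℝ → ℝ), (∀ t, 0 < t → v t = w t) →
      ∫ t, ψ t * u t * (v t : ℂ) = ∫ t, ψ t * u t * (w t : ℂ) := by
    intro u v w h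
    refine integral_congr_ae (Filter.Eventually.of_forall fun t => ?_)
    by_cases ht : t ∈ tsupport ψ
    · simp only [h t (hψ0 ht)]
    · simp [image_eq_zero_of_notMem_tsupport ht]
  refine ⟨K + K', by positivity, fun ξ τ => ?_⟩
  set h := hSymbol α ξ with hh
  have h0 : 0 ≤ h := hSymbol_nonneg α ξ
  have hle : h ≤ 1 + √(1 / aCoeff α) := hSymbol_le hα hα' ξ
  set W := ((1 + |τ|) ^ N)⁻¹ with hW
  have hW0 : 0 ≤ W := by positivity
  fin_cases j
  · change ‖∫ t, ψ t * Complex.exp (-Complex.I * (t * τ : ℝ)) * (fundSymbol α 0 t ξ : ℂ)‖ ≤ _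
    rw [hcongr _ (fun t => fundSymbol α 0 t ξ) (fun t => Real.cos (h * t))
      (fun t ht => by simp [fundSymbol, ht, hh]), integral_mul_exp_mul_cos]
    have h1 := hK (τ - h) τ (by rw [sub_sub_cancel, abs_of_nonneg h0]; exact hle)
    have h2 := hK (τ + h) τ (by rw [sub_add_cancel_left, abs_neg, abs_of_nonneg h0]; exact hle)
    rw [norm_div, Complex.norm_two, div_le_iff₀ two_pos]
    refine (norm_add_le _ _).trans ?_
    nlinarith [mul_nonneg hK'0 hW0]
  · change ‖∫ t, ψ t * Complex.exp (-Complex.I * (t * τ : ℝ)) * (fundSymbol α 1 t ξ : ℂ)‖ ≤ _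
    rw [hcongr _ (fun t => fundSymbol α 1 t ξ) (fun t => Real.sin (h * t) / h)
      (fun t ht => by simp [fundSymbol, ht, hh])]
    simp only [Complex.ofReal_div, ← mul_div_assoc]
    rw [integral_div, integral_mul_exp_mul_sin]
    -- The quotient by `h` is controlled by the mean value inequality on `[τ - h, τ + h]`.
    have hmv : ‖𝓕ₛ ψ ((τ + h) / (2 * Real.pi)) - 𝓕ₛ ψ ((τ - h) / (2 * Real.pi))‖ ≤
        K' * W * (2 * h) := by
      have hpi := Real.pi_gt_three
      have hder : ∀ σ : ℝ, HasDerivAt (fun σ => 𝓕ₛ ψ (σ / (2 * Real.pi)))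
          ((2 * Real.pi)⁻¹ • SchwartzMap.derivCLM ℂ ℂ (𝓕ₛ ψ) (σ / (2 * Real.pi))) σ := fun σ => by
        have h1 := ((𝓕ₛ ψ).differentiableAt (x := σ / (2 * Real.pi))).hasDerivAt.scomp σ
          ((hasDerivAt_id σ).div_const (2 * Real.pi))
        simpa [Function.comp_def] using h1
      have := (convex_Icc (τ - h) (τ + h)).norm_image_sub_le_of_norm_hasDerivWithin_le
        (f := fun σ => 𝓕ₛ ψ (σ / (2 * Real.pi))) (C := K' * W) (x := τ - h) (y := τ + h)
        (fun σ _ => (hder σ).hasDerivWithinAt) (fun σ hσ => ?_)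
        ⟨le_rfl, by linarith⟩ ⟨by linarith, le_rfl⟩
      · rwa [show τ + h - (τ - h) = 2 * h by ring, Real.norm_of_nonneg (by linarith)] at this
      · rw [norm_smul, Real.norm_of_nonneg (by positivity)]
        refine (mul_le_of_le_one_left (norm_nonneg _) (inv_le_one_of_one_le₀ (by linarith))).trans
          (hK' σ τ ?_)
        exact (abs_le.2 ⟨by linarith [hσ.2], by linarith [hσ.1]⟩ : |τ - σ| ≤ h).trans hle
    rw [norm_div, norm_div, norm_mul, Complex.norm_I, mul_one, Complex.norm_two, Complex.norm_real,
      Real.norm_of_nonneg h0]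
    rcases h0.eq_or_lt with h00 | hpos
    -- For `h = 0` the quotient has the junk value `0`.
    · rw [← h00, div_zero]; positivity
    · rw [div_le_iff₀ hpos, div_le_iff₀ two_pos]
      refine hmv.trans ?_
      nlinarith [mul_nonneg (mul_nonneg hK0 hW0) h0]

/-- The localized Fourier transform decreases rapidly in `τ`, for any spatial cut-off. -/
theorem exists_fourierCutoff_le {α : ℝ} (hα : 2 ≤ α) (hα' : α < 3) (j : Fin 2)
    {χ ψ : 𝓢(ℝ, ℂ)} (hχ : HasCompactSupport χ) (hψ : HasCompactSupport ψ)
    (hψ0 : tsupport ψ ⊆ Set.Ioi 0) (N : ℕ) :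
    ∃ K : ℝ, 0 ≤ K ∧ ∀ ξ τ : ℝ,
      ‖fourierCutoff (fundSolutionPlus α j) (prodTest χ ψ hχ hψ hψ0) (ξ, τ)‖ ≤
        K * ((1 + |τ|) ^ N)⁻¹ := by
  obtain ⟨K, hK0, hK⟩ := exists_norm_integral_time_le hα hα' j hψ0 N
  refine ⟨(∫ η, ‖𝓕ₛ χ η‖) * K, by positivity, fun ξ τ => ?_⟩
  set y := ξ / (2 * Real.pi) with hy
  have hint : Integrable (fun p : ℝ × ℝ => ψ p.1 * Complex.exp (-Complex.I * (p.1 * τ : ℝ)) *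
      (𝓕ₛ χ (y - p.2) * (fundSymbol α j p.1 (2 * Real.pi * p.2) : ℂ)))
      ((volume : Measure ℝ).prod volume) := by
    have hψ1 : Integrable fun t : ℝ => (1 + |t|) * ‖ψ t‖ := by
      have h1 := ψ.integrable.norm.add (ψ.integrable_pow_mul volume 1)
      refine h1.congr (Filter.Eventually.of_forall fun t => ?_)
      simp [add_mul]
    refine (hψ1.mul_prod ((𝓕ₛ χ).integrable.comp_sub_left y).norm).mono' ?_
      (Filter.Eventually.of_forall fun p => ?_)
    · refine AEStronglyMeasurable.mul (Continuous.aestronglyMeasurable ?_)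
        (AEStronglyMeasurable.mul (Continuous.aestronglyMeasurable ?_)
          (measurable_fundSymbol_scaled α j).aestronglyMeasurable)
      · have := ψ.continuous
        fun_prop
      · exact (𝓕ₛ χ).continuous.comp (by fun_prop)
    · rw [norm_mul, norm_mul, norm_mul, norm_exp_neg_I_mul, mul_one, Complex.norm_real]
      have := abs_fundSymbol_le α j p.1 (2 * Real.pi * p.2)
      calc ‖ψ p.1‖ * (‖𝓕ₛ χ (y - p.2)‖ * |fundSymbol α j p.1 (2 * Real.pi * p.2)|)
          ≤ ‖ψ p.1‖ * (‖𝓕ₛ χ (y - p.2)‖ * (1 + |p.1|)) := by gcongr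
        _ = (1 + |p.1|) * ‖ψ p.1‖ * ‖𝓕ₛ χ (y - p.2)‖ := by ring
  have hswap : fourierCutoff (fundSolutionPlus α j) (prodTest χ ψ hχ hψ hψ0) (ξ, τ) =
      ∫ η, 𝓕ₛ χ (y - η) * ∫ t, ψ t * Complex.exp (-Complex.I * (t * τ : ℝ)) *
        (fundSymbol α j t (2 * Real.pi * η) : ℂ) := by
    rw [fourierCutoff_prodTest]
    calc _ = ∫ t, ∫ η, ψ t * Complex.exp (-Complex.I * (t * τ : ℝ)) *
          (𝓕ₛ χ (y - η) * (fundSymbol α j t (2 * Real.pi * η) : ℂ)) := by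
          congr 1; ext t; rw [integral_const_mul]
      _ = ∫ η, ∫ t, ψ t * Complex.exp (-Complex.I * (t * τ : ℝ)) *
          (𝓕ₛ χ (y - η) * (fundSymbol α j t (2 * Real.pi * η) : ℂ)) :=
          integral_integral_swap hint
      _ = _ := by
          congr 1; ext η; rw [← integral_const_mul]; congr 1; ext t; ring
  rw [hswap, mul_assoc, ← integral_sub_left_eq_self (fun s => ‖𝓕ₛ χ s‖) volume y,
    ← integral_mul_const]
  refine norm_integral_le_of_norm_le
    (((𝓕ₛ χ).integrable.comp_sub_left y).norm.mul_const _)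
    (Filter.Eventually.of_forall fun η => ?_)
  rw [norm_mul]
  exact mul_le_mul_of_nonneg_left (hK _ _) (norm_nonneg _)

/-! ### Microlocal smoothness -/

theorem exists_bump {c : ℝ} {U : Set ℝ} (hU : U ∈ nhds c) :
    ∃ χ : 𝓢(ℝ, ℂ), HasCompactSupport χ ∧ tsupport χ ⊆ U ∧ χ c ≠ 0 := by
  obtain ⟨f, hf, hf', hf'', -, hf1⟩ := exists_contDiff_tsupport_subset (n := ⊤) hU
  have hsub : tsupport (fun x => (f x : ℂ)) ⊆ tsupport f :=
    closure_mono fun x hx => by simpa using hx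
  exact ⟨(hf'.comp_left (g := fun r : ℝ => (r : ℂ)) Complex.ofReal_zero).toSchwartzMap
    (Complex.ofRealCLM.contDiff.comp hf''), hf'.comp_left Complex.ofReal_zero,
    hsub.trans hf, (by simp [hf1] : (f c : ℂ) ≠ 0)⟩

theorem isMicrolocallySmoothAt_of_fst_ne_zero {α : ℝ} (hα : 2 ≤ α) (hα' : α < 3) (j : Fin 2)
    {x t : ℝ} (hx : x ≠ 0) (ht : 0 < t) (ζ₀ : ℝ × ℝ) :
    IsMicrolocallySmoothAt (fundSolutionPlus α j) (x, t) ζ₀ := by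
  obtain ⟨χ, hχ, hχU, hχx⟩ := exists_bump (isOpen_compl_singleton.mem_nhds hx : {0}ᶜ ∈ nhds x)
  obtain ⟨ψ, hψ, hψU, hψt⟩ := exists_bump (Ioi_mem_nhds ht)
  refine ⟨prodTest χ ψ hχ hψ hψU, mul_ne_zero hχx hψt, Set.univ, isOpen_univ, trivial,
    fun _ _ _ _ => trivial, fun N => ?_⟩
  obtain ⟨K₁, hK₁0, hK₁⟩ := exists_fourierCutoff_le_of_notMem hα hα' j hχ hψ hψU
    (fun h => hχU h rfl) N
  obtain ⟨K₂, hK₂0, hK₂⟩ := exists_fourierCutoff_le hα hα' j hχ hψ hψU N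
  refine ⟨K₁ + K₂, fun ⟨ξ, τ⟩ _ => ?_⟩
  rw [Prod.norm_def, Real.norm_eq_abs, Real.norm_eq_abs, add_mul]
  have h1 : 0 ≤ K₁ * ((1 + max |ξ| |τ|) ^ N)⁻¹ := by positivity
  have h2 : 0 ≤ K₂ * ((1 + max |ξ| |τ|) ^ N)⁻¹ := by positivity
  rcases le_total |τ| |ξ| with h | h
  · have := hK₁ ξ τ
    rw [max_eq_left h] at h2 ⊢
    linarith
  · have := hK₂ ξ τ
    rw [max_eq_right h] at h1 ⊢
    linarith

theorem isMicrolocallySmoothAt_of_snd_ne_zero {α : ℝ} (hα : 2 ≤ α) (hα' : α < 3) (j : Fin 2)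
    (x : ℝ) {t : ℝ} (ht : 0 < t) (ξ₀ : ℝ) {τ₀ : ℝ} (hτ : τ₀ ≠ 0) :
    IsMicrolocallySmoothAt (fundSolutionPlus α j) (x, t) (ξ₀, τ₀) := by
  obtain ⟨χ, hχ, -, hχx⟩ := exists_bump (Filter.univ_mem : Set.univ ∈ nhds x)
  obtain ⟨ψ, hψ, hψU, hψt⟩ := exists_bump (Ioi_mem_nhds ht)
  -- An aperture for which the cone `|ξ| < M |τ|` contains `(ξ₀, τ₀)`.
  set M := |ξ₀| / |τ₀| + 1 with hM
  have hM1 : 1 ≤ M := by rw [hM]; linarith [div_nonneg (abs_nonneg ξ₀) (abs_nonneg τ₀)]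
  refine ⟨prodTest χ ψ hχ hψ hψU, mul_ne_zero hχx hψt, {ζ | |ζ.1| < M * |ζ.2|},
    isOpen_lt (by fun_prop) (by fun_prop), ?_, fun ζ hζ s hs => ?_, fun N => ?_⟩
  · have h0 := abs_pos.2 hτ
    change |ξ₀| < M * |τ₀|
    rw [hM, add_mul, div_mul_cancel₀ _ h0.ne']
    linarith
  · change |s * ζ.1| < M * |s * ζ.2|
    have hζ' : |ζ.1| < M * |ζ.2| := hζ
    rw [abs_mul, abs_mul, abs_of_pos hs]
    nlinarith
  · obtain ⟨K, hK0, hK⟩ := exists_fourierCutoff_le hα hα' j hχ hψ hψU N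
    refine ⟨K * M ^ N, fun ⟨ξ, τ⟩ hζ => (hK ξ τ).trans ?_⟩
    have hζ' : |ξ| < M * |τ| := hζ
    rw [mul_assoc]
    refine mul_le_mul_of_nonneg_left (inv_pow_le_of_le_mul (by positivity) (by positivity)
      (by positivity) ?_ N) hK0
    rw [Prod.norm_def, Real.norm_eq_abs, Real.norm_eq_abs, mul_add, mul_one]
    refine add_le_add hM1 (max_le hζ'.le ?_)
    exact le_mul_of_one_le_left (abs_nonneg _) hM1

end Eringen

end

theorem mainTheorem2 (α : ℝ) (hα : 2 ≤ α) (hα' : α < 3) (j : Fin 2) :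
    Eringen.waveFrontSet (Eringen.fundSolutionPlus α j) ⊆
      {p | ∃ t ξ : ℝ, 0 < t ∧ ξ ≠ 0 ∧ p = (((0 : ℝ), t), (ξ, (0 : ℝ)))} := by
  rintro ⟨⟨x, t⟩, ⟨ξ, τ⟩⟩ ⟨ht, hζ, hns⟩
  have ht : 0 < t := ht
  have hx : x = 0 := by
    by_contra hx
    exact hns (Eringen.isMicrolocallySmoothAt_of_fst_ne_zero hα hα' j hx ht _)
  have hτ : τ = 0 := by
    by_contra hτ
    exact hns (Eringen.isMicrolocallySmoothAt_of_snd_ne_zero hα hα' j x ht ξ hτ)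
  subst hx hτ
  exact ⟨t, ξ, ht, fun h => hζ (by simp [h]), rfl⟩
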